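/- Let $n\ge 0$. Write $\langle g,h\rangle=\sum_i g_ih_i$ for the standard scalar product on $\mathbb Z_2^n$. A $\mathbb Z_2^n$-supermanifold $\mathcal M=(M,\mathcal A_M)$ of dimension $p|\mathbf q$, where $\mathbf q=(q_k)_{k\in\mathbb Z_2^n\setminus\{0\}}$, is a Hausdorff, second-countable topological space $M$ with a sheaf $\mathcal A_M$ of $\mathbb Z_2^n$-graded associative unital $\mathbb R$-algebras that are $\mathbb Z_2^n$-commutative (i.e. $ab=(-1)^{\langle \deg a,\deg b\rangle}ba$ for homogeneous $a,b$), whose stalks each have a unique maximal homogeneous ideal, and which is locally isomorphic, by isomorphisms of graded unital $\mathbb R$-algebras compatible with restrictions, to a superdomain $(V,C^\infty_V[[\xi^1,\dots,\xi^q]])$. Here $V\subset\mathbb R^p$ is open and $\xi^1,\dots,\xi^q$ are formal variables of nonzero degrees in $\mathbb Z_2^n$, exactly $q_k$ of them of degree $k$, which commute according to the same sign rule. For open $U\subset M$, $f\in\mathcal A_M(U)$ and $m\in U$, let $\varepsilon(f)(m)$ be the unique real number $k$ such that $f-k$ is not invertible in any neighborhood of $m$. The space $M$ carries the smooth structure of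 dimension $p$ given by the base maps of these local isomorphisms. The support of $f$ is the complement in $U$ of the largest open subset of $U$ on which $f$ vanishes. **Proposition 7.6.** Let $\mathcal M=(M,\mathcal A_M)$ be a $\mathbb Z_2^n$-supermanifold and let $(U_i)_i$ be an open cover of $M$. Then there are a locally finite open cover $(V_j)_j$ of $M$, such that each $V_j$ is contained in some $U_i$, and a family $(s_j)_j$ of global sections $s_j\in\mathcal A_M^0(M)$ of degree $0$, with the same index set, such that, for every $j$, the projection $\gamma_j:=\varepsilon(s_j)$ is a smooth nonnegative function on $M$ and the support of $s_j$ is compact and contained in $V_j$, and such that $\sum_j s_j=1$ (a locally finite sum). -/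

import Mathlib

open CategoryTheory TopologicalSpace Opposite
open scoped Manifold ContDiff

universe u v

noncomputable section

namespace Z2n

/-! ### Degrees and signs -/

/-- The grading group `ℤ₂ⁿ`. -/
abbrev Deg (n : ℕ) : Type := Fin n → ZMod 2

/-- The commutation factor `(-1)^⟨g, h⟩`, where `⟨g, h⟩ = ∑ gᵢ hᵢ` is the standard scalar product. -/
def sgn {n : ℕ} (g h : Deg n) : ℤ := (-1) ^ (∑ i, (g i).val * (h i).val)

/-- A degree is odd if the sum of its components is `1` in `ℤ₂`. -/
def IsOddDeg {n : ℕ} (g : Deg n) : Prop := ∑ i, g i = 1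

/-! ### Formal power series in graded-commuting variables -/

section Series

variable {n q : ℕ}

/-- A multi-index is admissible if the exponent of each odd variable is at most `1`
(the square of an odd variable vanishes). -/
def Admissible (σ : Fin q → Deg n) (μ : Fin q →₀ ℕ) : Prop :=
  ∀ a, IsOddDeg (σ a) → μ a ≤ 1

/-- The reordering sign: `ξ^μ ξ^ν = reorderSign σ μ ν • ξ^(μ + ν)`. Each `ξᵇ` of the second
monomial is moved to the left past every `ξᵃ`, `b < a`, of the first one. -/
def reorderSign (σ : Fin q → Deg n) (μ ν : Fin q →₀ ℕ) : ℤ :=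
  ∏ a, ∏ b, if b < a then sgn (σ a) (σ b) ^ (μ a * ν b) else 1

/-- The formal power series `∑ f_μ ξ^μ` over `R` in variables `ξ¹, …, ξ^q` of degrees
`σ₁, …, σ_q`, which commute according to `ξᵃ ξᵇ = (-1)^⟨σ_a, σ_b⟩ ξᵇ ξᵃ`; here
`ξ^μ = (ξ¹)^μ₁ ⋯ (ξ^q)^μ_q`, and only admissible `μ` occur. -/
@[ext] structure FormalSeries (R : Type*) [CommRing R] (σ : Fin q → Deg n) where
  /-- the coefficients `f_μ` -/
  coeff : (Fin q →₀ ℕ) → R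
  coeff_eq_zero : ∀ μ, ¬ Admissible σ μ → coeff μ = 0

namespace FormalSeries

variable {R : Type*} [CommRing R] {σ : Fin q → Deg n}

theorem coeff_injective : Function.Injective (coeff : FormalSeries R σ → _) :=
  fun _ _ h => FormalSeries.ext h

instance : Zero (FormalSeries R σ) := ⟨⟨0, fun _ _ => rfl⟩⟩

instance : Add (FormalSeries R σ) :=
  ⟨fun f g => ⟨f.coeff + g.coeff, fun μ h => by
    simp [f.coeff_eq_zero μ h, g.coeff_eq_zero μ h]⟩⟩

instance : Neg (FormalSeries R σ) :=
  ⟨fun f => ⟨-f.coeff, fun μ h => by simp [f.coeff_eq_zero μ h]⟩⟩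

instance : Sub (FormalSeries R σ) :=
  ⟨fun f g => ⟨f.coeff - g.coeff, fun μ h => by
    simp [f.coeff_eq_zero μ h, g.coeff_eq_zero μ h]⟩⟩

instance {S : Type*} [SMulZeroClass S R] : SMul S (FormalSeries R σ) :=
  ⟨fun c f => ⟨c • f.coeff, fun μ h => by simp [f.coeff_eq_zero μ h]⟩⟩

instance : AddCommGroup (FormalSeries R σ) :=
  coeff_injective.addCommGroup coeff rfl (fun _ _ => rfl) (fun _ => rfl) (fun _ _ => rfl)
    (fun _ _ => rfl) (fun _ _ => rfl)

/-- Taking coefficients, as an additive map. -/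
def coeffHom (R : Type*) [CommRing R] (σ : Fin q → Deg n) :
    FormalSeries R σ →+ ((Fin q →₀ ℕ) → R) where
  toFun := coeff
  map_zero' := rfl
  map_add' _ _ := rfl

instance {S : Type*} [Semiring S] [Module S R] : Module S (FormalSeries R σ) :=
  coeff_injective.module S (coeffHom R σ) (fun _ _ => rfl)

open Classical in
instance : One (FormalSeries R σ) :=
  ⟨⟨fun μ => if μ = 0 then 1 else 0, fun μ h => by
    rw [if_neg]
    rintro rfl
    exact h fun a _ => by simp⟩⟩

open Classical in
/-- The product determined by `ξ^μ ξ^ν = ± ξ^(μ + ν)`, which is `0` if `μ + ν` is not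
admissible; the coefficients are central. -/
instance : Mul (FormalSeries R σ) :=
  ⟨fun f g => ⟨fun l => if Admissible σ l then
      ∑ x ∈ Finset.HasAntidiagonal.antidiagonal l,
        reorderSign σ x.1 x.2 • (f.coeff x.1 * g.coeff x.2) else 0,
    fun _ h => if_neg h⟩⟩

theorem zero_coeff (l : Fin q →₀ ℕ) : (0 : FormalSeries R σ).coeff l = 0 := rfl

theorem add_coeff (f g : FormalSeries R σ) (l : Fin q →₀ ℕ) :
    (f + g).coeff l = f.coeff l + g.coeff l := rfl

theorem smul_coeff {S : Type*} [SMulZeroClass S R] (c : S) (f : FormalSeries R σ)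
    (l : Fin q →₀ ℕ) : (c • f).coeff l = c • f.coeff l := rfl

open Classical in
theorem one_coeff (l : Fin q →₀ ℕ) :
    (1 : FormalSeries R σ).coeff l = if l = 0 then 1 else 0 := rfl

theorem mul_coeff (f g : FormalSeries R σ) (l : Fin q →₀ ℕ) (h : Admissible σ l) :
    (f * g).coeff l =
      ∑ x ∈ Finset.HasAntidiagonal.antidiagonal l,
        reorderSign σ x.1 x.2 • (f.coeff x.1 * g.coeff x.2) :=
  if_pos h

theorem reorderSign_add_left (σ : Fin q → Deg n) (μ ν l : Fin q →₀ ℕ) :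
    reorderSign σ (μ + ν) l = reorderSign σ μ l * reorderSign σ ν l := by
  simp only [reorderSign, ← Finset.prod_mul_distrib]
  refine Finset.prod_congr rfl fun a _ => Finset.prod_congr rfl fun b _ => ?_
  split_ifs
  · rw [Finsupp.add_apply, add_mul, pow_add]
  · simp

theorem reorderSign_add_right (σ : Fin q → Deg n) (l μ ν : Fin q →₀ ℕ) :
    reorderSign σ l (μ + ν) = reorderSign σ l μ * reorderSign σ l ν := by
  simp only [reorderSign, ← Finset.prod_mul_distrib]
  refine Finset.prod_congr rfl fun a _ => Finset.prod_congr rfl fun b _ => ?_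
  split_ifs
  · rw [Finsupp.add_apply, mul_add, pow_add]
  · simp

theorem reorderSign_zero_left (σ : Fin q → Deg n) (μ : Fin q →₀ ℕ) :
    reorderSign σ 0 μ = 1 := by
  simp [reorderSign]

theorem reorderSign_zero_right (σ : Fin q → Deg n) (μ : Fin q →₀ ℕ) :
    reorderSign σ μ 0 = 1 := by
  simp [reorderSign]

theorem Admissible.of_le {μ ν : Fin q →₀ ℕ} (h : Admissible σ ν) (hle : μ ≤ ν) :
    Admissible σ μ :=
  fun a ha => (hle a).trans (h a ha)

protected theorem one_mul (f : FormalSeries R σ) : 1 * f = f := by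
  classical
  ext l
  by_cases h : Admissible σ l
  · rw [mul_coeff _ _ _ h, Finset.sum_eq_single (0, l)]
    · simp [one_coeff, reorderSign_zero_left]
    · rintro ⟨a, b⟩ hab hne
      have : a ≠ 0 := by
        rintro rfl
        exact hne (by simpa using hab)
      simp [one_coeff, this]
    · simp
  · rw [coeff_eq_zero _ _ h, coeff_eq_zero _ _ h]

protected theorem mul_one (f : FormalSeries R σ) : f * 1 = f := by
  classical
  ext l
  by_cases h : Admissible σ l
  · rw [mul_coeff _ _ _ h, Finset.sum_eq_single (l, 0)]
    · simp [one_coeff, reorderSign_zero_right]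
    · rintro ⟨a, b⟩ hab hne
      have : b ≠ 0 := by
        rintro rfl
        exact hne (by simpa using hab)
      simp [one_coeff, this]
    · simp
  · rw [coeff_eq_zero _ _ h, coeff_eq_zero _ _ h]

protected theorem mul_assoc (f g k : FormalSeries R σ) : f * g * k = f * (g * k) := by
  classical
  ext l
  by_cases h : Admissible σ l
  · rw [mul_coeff _ _ _ h, mul_coeff _ _ _ h]
    have h1 : ∀ x ∈ Finset.HasAntidiagonal.antidiagonal l,
        reorderSign σ x.1 x.2 • ((f * g).coeff x.1 * k.coeff x.2) =
        ∑ y ∈ Finset.HasAntidiagonal.antidiagonal x.1, (reorderSign σ x.1 x.2 * reorderSign σ y.1 y.2) •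
          (f.coeff y.1 * g.coeff y.2 * k.coeff x.2) := by
      intro x hx
      have hle := (le_self_add : _ ≤ x.1 + x.2).trans_eq (Finset.HasAntidiagonal.mem_antidiagonal.1 hx)
      rw [mul_coeff _ _ _ (Admissible.of_le h hle), Finset.sum_mul, Finset.smul_sum]
      exact Finset.sum_congr rfl fun y _ => by rw [smul_mul_assoc, smul_smul]
    have h2 : ∀ x ∈ Finset.HasAntidiagonal.antidiagonal l,
        reorderSign σ x.1 x.2 • (f.coeff x.1 * (g * k).coeff x.2) =
        ∑ y ∈ Finset.HasAntidiagonal.antidiagonal x.2, (reorderSign σ x.1 x.2 * reorderSign σ y.1 y.2) •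
          (f.coeff x.1 * (g.coeff y.1 * k.coeff y.2)) := by
      intro x hx
      have hle := (le_add_self : _ ≤ x.1 + x.2).trans_eq (Finset.HasAntidiagonal.mem_antidiagonal.1 hx)
      rw [mul_coeff _ _ _ (Admissible.of_le h hle), Finset.mul_sum, Finset.smul_sum]
      exact Finset.sum_congr rfl fun y _ => by rw [mul_smul_comm, smul_smul]
    rw [Finset.sum_congr rfl h1, Finset.sum_congr rfl h2, Finset.sum_sigma', Finset.sum_sigma']
    refine Finset.sum_nbij' (fun ⟨⟨_, j⟩, ⟨u, v⟩⟩ => ⟨(u, v + j), (v, j)⟩)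
      (fun ⟨⟨i, _⟩, ⟨u, v⟩⟩ => ⟨(i + u, v), (i, u)⟩) ?_ ?_ ?_ ?_ ?_
    · rintro ⟨⟨i, j⟩, ⟨u, v⟩⟩ hx
      simp only [Finset.mem_sigma, Finset.HasAntidiagonal.mem_antidiagonal] at hx ⊢
      exact ⟨by rw [← add_assoc, hx.2, hx.1], trivial⟩
    · rintro ⟨⟨i, j⟩, ⟨u, v⟩⟩ hx
      simp only [Finset.mem_sigma, Finset.HasAntidiagonal.mem_antidiagonal] at hx ⊢
      exact ⟨by rw [add_assoc, hx.2, hx.1], trivial⟩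
    · rintro ⟨⟨i, j⟩, ⟨u, v⟩⟩ hx
      simp only [Finset.mem_sigma, Finset.HasAntidiagonal.mem_antidiagonal] at hx
      obtain ⟨-, rfl⟩ := hx
      rfl
    · rintro ⟨⟨i, j⟩, ⟨u, v⟩⟩ hx
      simp only [Finset.mem_sigma, Finset.HasAntidiagonal.mem_antidiagonal] at hx
      obtain ⟨-, rfl⟩ := hx
      rfl
    · rintro ⟨⟨i, j⟩, ⟨u, v⟩⟩ hx
      simp only [Finset.mem_sigma, Finset.HasAntidiagonal.mem_antidiagonal] at hx
      obtain ⟨-, rfl⟩ := hx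
      simp only [reorderSign_add_left, reorderSign_add_right, mul_assoc]
      congr 1
      ring
  · rw [coeff_eq_zero _ _ h, coeff_eq_zero _ _ h]

protected theorem mul_add (f g k : FormalSeries R σ) : f * (g + k) = f * g + f * k := by
  ext l
  by_cases h : Admissible σ l
  · simp only [add_coeff, mul_coeff _ _ _ h, mul_add, smul_add, Finset.sum_add_distrib]
  · rw [coeff_eq_zero _ _ h, coeff_eq_zero _ _ h]

protected theorem add_mul (f g k : FormalSeries R σ) : (f + g) * k = f * k + g * k := by
  ext l
  by_cases h : Admissible σ l
  · simp only [add_coeff, mul_coeff _ _ _ h, add_mul, smul_add, Finset.sum_add_distrib]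
  · rw [coeff_eq_zero _ _ h, coeff_eq_zero _ _ h]

instance : Ring (FormalSeries R σ) where
  __ := (inferInstance : AddCommGroup (FormalSeries R σ))
  one_mul := FormalSeries.one_mul
  mul_one := FormalSeries.mul_one
  mul_assoc := FormalSeries.mul_assoc
  left_distrib := FormalSeries.mul_add
  right_distrib := FormalSeries.add_mul
  zero_mul f := by
    ext l
    by_cases h : Admissible σ l
    · simp [mul_coeff _ _ _ h, zero_coeff]
    · rw [coeff_eq_zero _ _ h, coeff_eq_zero _ _ h]
  mul_zero f := by
    ext l
    by_cases h : Admissible σ l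
    · simp [mul_coeff _ _ _ h, zero_coeff]
    · rw [coeff_eq_zero _ _ h, coeff_eq_zero _ _ h]

instance {S : Type*} [CommRing S] [Algebra S R] : Algebra S (FormalSeries R σ) :=
  Algebra.ofModule
    (fun c f g => by
      ext l
      by_cases h : Admissible σ l
      · simp only [smul_coeff, mul_coeff _ _ _ h, Finset.smul_sum, smul_mul_assoc]
        exact Finset.sum_congr rfl fun x _ => smul_comm _ _ _
      · rw [coeff_eq_zero _ _ h, coeff_eq_zero _ _ h])
    (fun c f g => by
      ext l
      by_cases h : Admissible σ l
      · simp only [smul_coeff, mul_coeff _ _ _ h, Finset.smul_sum, mul_smul_comm]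
        exact Finset.sum_congr rfl fun x _ => smul_comm _ _ _
      · rw [coeff_eq_zero _ _ h, coeff_eq_zero _ _ h])

/-- The homogeneous series of degree `g`: only monomials `ξ^μ` of degree
`∑ μ_a σ_a = g` occur. -/
def grade (S : Type*) [CommRing S] [Algebra S R] (g : Deg n) :
    Submodule S (FormalSeries R σ) where
  carrier := {f | ∀ μ : Fin q →₀ ℕ, ∑ a, μ a • σ a ≠ g → f.coeff μ = 0}
  zero_mem' _ _ := rfl
  add_mem' {f k} hf hk μ h := by rw [add_coeff, hf μ h, hk μ h, add_zero]
  smul_mem' c f hf μ h := by rw [smul_coeff, hf μ h, smul_zero]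

/-- Apply a ring homomorphism to all coefficients. -/
def map {R' : Type*} [CommRing R'] (φ : R →+* R') (f : FormalSeries R σ) : FormalSeries R' σ :=
  ⟨fun μ => φ (f.coeff μ), fun μ h => by rw [f.coeff_eq_zero μ h, map_zero]⟩

end FormalSeries

end Series

/-! ### Superdomains -/

section Domain

variable {n p q : ℕ}

/-- The ring `C^∞(W)` of smooth real functions on an open set `W ⊆ ℝᵖ`. -/
abbrev Smooth (W : Opens (EuclideanSpace ℝ (Fin p))) : Type :=
  C^∞⟮𝓘(ℝ, EuclideanSpace ℝ (Fin p)), W; 𝓘(ℝ, ℝ), ℝ⟯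

/-- The algebra `C^∞(W)[[ξ¹, …, ξ^q]]` of functions of the superdomain, over `W ⊆ ℝᵖ` open. -/
abbrev DomainFun (σ : Fin q → Deg n) (W : Opens (EuclideanSpace ℝ (Fin p))) : Type :=
  FormalSeries (Smooth W) σ

/-- Restriction of functions of the superdomain, coefficient by coefficient. -/
def DomainFun.restrict {σ : Fin q → Deg n} {W' W : Opens (EuclideanSpace ℝ (Fin p))}
    (h : W' ≤ W) (f : DomainFun σ W) : DomainFun σ W' :=
  FormalSeries.map
    (ContMDiffMap.restrictRingHom 𝓘(ℝ, EuclideanSpace ℝ (Fin p)) 𝓘(ℝ, ℝ) ℝ h) f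

end Domain

/-! ### Locally ringed spaces with a `ℤ₂ⁿ`-grading -/

/-- A `ℤ₂ⁿ`-ringed space: a Hausdorff, second-countable space with a sheaf of `ℤ₂ⁿ`-graded,
`ℤ₂ⁿ`-commutative, associative, unital `ℝ`-algebras. -/
structure RingedSpace (n : ℕ) where
  /-- the underlying topological space -/
  space : TopCat.{u}
  [t2 : T2Space space]
  [secondCountable : SecondCountableTopology space]
  /-- the structure sheaf -/
  sheaf : TopCat.Sheaf (AlgCat.{u} ℝ) space
  /-- the homogeneous sections of each degree -/
  grade : (U : Opens space) → Deg n → Submodule ℝ (sheaf.1.obj (op U))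
  graded_mul : ∀ U, SetLike.GradedMonoid (grade U)
  isInternal : ∀ U, DirectSum.IsInternal (grade U)
  map_grade : ∀ {U V : Opens space} (h : V ≤ U) (g : Deg n), ∀ s ∈ grade U g,
    (sheaf.1.map (homOfLE h).op).hom s ∈ grade V g
  graded_comm : ∀ (U : Opens space) (g h : Deg n), ∀ s ∈ grade U g, ∀ t ∈ grade U h,
    s * t = sgn g h • (t * s)

namespace RingedSpace

attribute [instance] RingedSpace.t2 RingedSpace.secondCountable

variable {n : ℕ} (X : RingedSpace.{u} n)

/-- The algebra of sections over an open set. -/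
abbrev sec (U : Opens X.space) : Type u := X.sheaf.1.obj (op U)

/-- The restriction maps. -/
def res {U V : Opens X.space} (h : V ≤ U) : X.sec U →ₐ[ℝ] X.sec V :=
  (X.sheaf.1.map (homOfLE h).op).hom

/-- The underlying presheaf of rings. -/
abbrev ringPresheaf : TopCat.Presheaf RingCat.{u} X.space :=
  X.sheaf.1 ⋙ forget₂ (AlgCat.{u} ℝ) RingCat.{u}

/-- The (ring underlying the) stalk at a point. -/
abbrev stalk (m : X.space) : RingCat.{u} := X.ringPresheaf.stalk m

/-- The germ of a section at a point. -/
def germ {U : Opens X.space} (m : X.space) (hm : m ∈ U) (s : X.sec U) : X.stalk m :=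
  (X.ringPresheaf.germ U m hm).hom s

/-- An element of the stalk is homogeneous if it is the germ of a homogeneous section. -/
def IsHomogeneousGerm (m : X.space) (x : X.stalk m) : Prop :=
  ∃ (U : Opens X.space) (hm : m ∈ U) (g : Deg n), ∃ s ∈ X.grade U g, X.germ m hm s = x

/-- An ideal of the stalk is homogeneous if it is generated by its homogeneous elements. (By
graded commutativity a homogeneous left ideal is two-sided.) -/
def IsHomogeneousIdeal (m : X.space) (I : Ideal (X.stalk m)) : Prop :=
  Ideal.span {x | x ∈ I ∧ X.IsHomogeneousGerm m x} = I

/-- An ideal of the stalk is maximal homogeneous if it is maximal among the proper homogeneous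
ideals. -/
def IsMaximalHomogeneousIdeal (m : X.space) (I : Ideal (X.stalk m)) : Prop :=
  Maximal (fun I : Ideal (X.stalk m) => X.IsHomogeneousIdeal m I ∧ I ≠ ⊤) I

/-- A locally `ℤ₂ⁿ`-ringed space: each stalk has a unique maximal homogeneous ideal. -/
def IsLocal : Prop := ∀ m : X.space, ∃! I, X.IsMaximalHomogeneousIdeal m I

/-- The support of a section `s` over `U`: the complement in `U` of the largest open subset on
which `s` vanishes. -/
def supp {U : Opens X.space} (s : X.sec U) : Set X.space :=
  {m | m ∈ U ∧ ∀ (V : Opens X.space) (h : V ≤ U), m ∈ V → X.res h s ≠ 0}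

/-- `γ` is the projection `ε(s)` of a section `s` over `U` to the base: for `m ∈ U`, the
value `γ m` is the unique real number `k` such that `s - k` is not invertible in any neighbourhood
of `m`. (The values of `γ` outside `U` are irrelevant.) -/
def IsProjection {U : Opens X.space} (s : X.sec U) (γ : X.space → ℝ) : Prop :=
  ∀ m ∈ U, ∀ k : ℝ, k = γ m ↔
    ∀ (V : Opens X.space) (h : V ≤ U), m ∈ V → ¬ IsUnit (X.res h s - algebraMap ℝ (X.sec V) k)

/-- `t` is the sum of the locally finite family `s` of sections over `U`: each point of `U` has a
neighbourhood on which all but finitely many `s j` vanish, and the sum of the others is `t`. -/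
def HasLocSum {U : Opens X.space} {J : Type*} (s : J → X.sec U) (t : X.sec U) : Prop :=
  ∀ m ∈ U, ∃ (V : Opens X.space) (h : V ≤ U), m ∈ V ∧ ∃ F : Finset J,
    (∀ j ∉ F, X.res h (s j) = 0) ∧ ∑ j ∈ F, X.res h (s j) = X.res h t

end RingedSpace

/-! ### Supermanifolds -/

/-- The open set `e⁻¹(W)` of the source of a chart `e`. -/
def chartPreimage {X Y : Type*} [TopologicalSpace X] [TopologicalSpace Y]
    (e : OpenPartialHomeomorph X Y) (W : Opens Y) : Opens X :=
  ⟨e.source ∩ e ⁻¹' W, e.isOpen_inter_preimage W.2⟩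

theorem chartPreimage_mono {X Y : Type*} [TopologicalSpace X] [TopologicalSpace Y]
    (e : OpenPartialHomeomorph X Y) {W' W : Opens Y} (h : W' ≤ W) :
    chartPreimage e W' ≤ chartPreimage e W :=
  fun _ hx => ⟨hx.1, h hx.2⟩

/-- An isomorphism of `ℤ₂ⁿ`-ringed spaces from an open part of `X` onto a superdomain over
an open set of `ℝᵖ` with formal variables of degrees `σ₁, …, σ_q`: a homeomorphism `base`
of an open subset of `X` onto an open subset of `ℝᵖ`, together with isomorphisms of graded unital
algebras (the pullbacks) that commute with restrictions. (Being isomorphisms, the pullbacks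
carry maximal homogeneous ideals of stalks to such ideals.) -/
structure Superchart {n : ℕ} (X : RingedSpace.{u} n) (p : ℕ) {q : ℕ} (σ : Fin q → Deg n) where
  base : OpenPartialHomeomorph X.space (EuclideanSpace ℝ (Fin p))
  pullback : ∀ W : Opens (EuclideanSpace ℝ (Fin p)), (W : Set _) ⊆ base.target →
    (DomainFun σ W ≃ₐ[ℝ] X.sec (chartPreimage base W))
  pullback_mem_grade : ∀ W hW g (f : DomainFun σ W),
    pullback W hW f ∈ X.grade (chartPreimage base W) g ↔ f ∈ FormalSeries.grade ℝ g
  res_pullback : ∀ W W' hW hW' (h : W' ≤ W) (f : DomainFun σ W),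
    X.res (chartPreimage_mono base h) (pullback W hW f) = pullback W' hW' (f.restrict h)

/-- A (smooth) `ℤ₂ⁿ`-supermanifold of dimension `p|d`, where `d k` is the number of formal
variables of degree `k`, for each nonzero degree `k`: a locally `ℤ₂ⁿ`-ringed space that
is locally isomorphic to a superdomain of this dimension. -/
structure Supermanifold (n p : ℕ) (d : {k : Deg n // k ≠ 0} → ℕ) extends RingedSpace.{u} n where
  isLocal : toRingedSpace.IsLocal
  exists_superchart : ∀ m : space, ∃ (q : ℕ) (σ : Fin q → {k : Deg n // k ≠ 0}),
    (∀ k, Nat.card {a // σ a = k} = d k) ∧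
    ∃ c : Superchart toRingedSpace p (fun a => (σ a : Deg n)), m ∈ c.base.source

/-- The smooth functions `C^∞(M)` of the base of a supermanifold, whose smooth structure is
the one given by the base maps of the supercharts. -/
def Supermanifold.IsSmooth {n p : ℕ} {d : {k : Deg n // k ≠ 0} → ℕ}
    (M : Supermanifold.{u} n p d) (γ : M.space → ℝ) : Prop :=
  ∀ (q : ℕ) (σ : Fin q → {k : Deg n // k ≠ 0}), (∀ k, Nat.card {a // σ a = k} = d k) →
    ∀ c : Superchart M.toRingedSpace p (fun a => (σ a : Deg n)),
      ContDiffOn ℝ ∞ (γ ∘ c.base.symm) c.base.target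

end Z2n

end

/-!
The classical construction of a smooth partition of unity carries over to supermanifolds because a
section is invertible as soon as its projection to the base vanishes nowhere.

The algebraic core is `FormalSeries.isUnit_of_isUnit_coeff_zero`: a formal series is invertible
when its constant coefficient is. Hence, in a superchart, a section is invertible near a point
exactly if the constant coefficient of its expression does not vanish there
(`Superchart.isEval_body`). So evaluation of the constant coefficient at a point `m` is an algebra
homomorphism `s ↦ ε(s)(m)` whose kernel is described without charts. This makes it independent of
the superchart, identifies it with the projection of the statement, and shows that `ε(s)` is smooth
in every superchart (`Supermanifold.isSmooth_eval`).

The base is locally compact and second countable, so the given cover has a locally finite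
refinement `V` by relatively compact domains inside supercharts, which can be shrunk to compact
sets `C j ⊆ V j` that still cover. A smooth bump function, read as a series with only a constant
term, gives a section `b j` of degree `0` with compact support in `V j` and projection positive on
`C j` (`Supermanifold.exists_bump`). The locally finite sum `S` of the `b j` exists by the sheaf
property and has positive projection, so it is invertible near each point and therefore globally.
Its inverse again has degree `0`, and the sections `S⁻¹ * b j` form the partition of unity.
-/

noncomputable section

namespace Z2n

/-! ### Invertible formal series -/

namespace FormalSeries

variable {n q : ℕ} {R : Type*} [CommRing R] {σ : Fin q → Deg n}

theorem admissible_zero : Admissible σ 0 := fun a _ => by simp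

/-- The constant coefficient `f ↦ f₀`, as an algebra homomorphism. -/
def constantCoeff (S : Type*) [CommRing S] [Algebra S R] : FormalSeries R σ →ₐ[S] R where
  toFun f := f.coeff 0
  map_one' := by simp [one_coeff]
  map_mul' f g := by
    simp [mul_coeff _ _ _ admissible_zero, reorderSign_zero_left]
  map_zero' := rfl
  map_add' _ _ := rfl
  commutes' c := by
    rw [Algebra.algebraMap_eq_smul_one, smul_coeff, one_coeff, if_pos rfl,
      Algebra.algebraMap_eq_smul_one]

open Classical in
/-- The coefficients of a right inverse of a series `f` with `f₀ * a = 1`, by recursion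
on the multi-index. -/
def invCoeff (a : R) (f : FormalSeries R σ) (l : Fin q →₀ ℕ) : R :=
  if Admissible σ l then
    if l = 0 then a else
      -a * ∑ x ∈ Finset.HasAntidiagonal.antidiagonal l,
        if _ : x.2 < l then reorderSign σ x.1 x.2 • (f.coeff x.1 * invCoeff a f x.2) else 0
  else 0
termination_by l

theorem exists_mul_eq_one (f : FormalSeries R σ) {a : R} (ha : f.coeff 0 * a = 1) :
    ∃ g : FormalSeries R σ, f * g = 1 ∧ g.coeff 0 = a := by
  classical
  let g : FormalSeries R σ := ⟨invCoeff a f, fun l hl => by rw [invCoeff, if_neg hl]⟩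
  have hg0 : g.coeff 0 = a := by
    change invCoeff a f 0 = a
    rw [invCoeff, if_pos admissible_zero, if_pos rfl]
  refine ⟨g, ?_, hg0⟩
  ext l
  by_cases h : Admissible σ l
  · rw [mul_coeff _ _ _ h, one_coeff]
    by_cases hl : l = 0
    · subst hl
      simp [reorderSign_zero_left, hg0, ha]
    · have hgl : g.coeff l = -a * ∑ x ∈ Finset.HasAntidiagonal.antidiagonal l,
          if x.2 < l then reorderSign σ x.1 x.2 • (f.coeff x.1 * g.coeff x.2) else 0 := by
        change invCoeff a f l = _
        rw [invCoeff, if_pos h, if_neg hl]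
        rfl
      have hmem : (0, l) ∈ Finset.HasAntidiagonal.antidiagonal l := by simp
      rw [if_neg hl, ← Finset.add_sum_erase _ _ hmem]
      rw [← Finset.add_sum_erase _ _ hmem, if_neg (lt_irrefl _), zero_add] at hgl
      -- The recursion expresses `f₀ gₗ` as minus the sum of the other terms of `(f g)ₗ`.
      have hsum : ∑ x ∈ (Finset.HasAntidiagonal.antidiagonal l).erase (0, l),
          (if x.2 < l then reorderSign σ x.1 x.2 • (f.coeff x.1 * g.coeff x.2) else 0) =
          ∑ x ∈ (Finset.HasAntidiagonal.antidiagonal l).erase (0, l),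
          reorderSign σ x.1 x.2 • (f.coeff x.1 * g.coeff x.2) := by
        refine Finset.sum_congr rfl fun x hx => if_pos ?_
        rw [Finset.mem_erase, Finset.HasAntidiagonal.mem_antidiagonal] at hx
        refine lt_of_le_of_ne (le_add_self.trans_eq hx.2) fun h2 => hx.1 ?_
        have h1 : x.1 = 0 := by simpa [h2] using hx.2
        exact Prod.ext h1 h2
      rw [hsum] at hgl
      rw [reorderSign_zero_left, one_smul, hgl, ← mul_assoc, mul_neg, ha]
      simp
  · rw [coeff_eq_zero _ _ h, coeff_eq_zero _ _ h]

/-- The ideal of series without constant term is pronilpotent, so a series is invertible as soon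
as its constant coefficient is. -/
theorem isUnit_of_isUnit_coeff_zero {f : FormalSeries R σ} (hf : IsUnit (f.coeff 0)) :
    IsUnit f := by
  obtain ⟨a, ha⟩ := hf.exists_right_inv
  obtain ⟨g, hg, hga⟩ := f.exists_mul_eq_one ha
  obtain ⟨k, hk, -⟩ := g.exists_mul_eq_one (a := f.coeff 0) (by rw [hga, mul_comm, ha])
  have : f = k := left_inv_eq_right_inv hg hk
  exact ⟨⟨f, g, hg, by rw [this, hk]⟩, rfl⟩

open Classical in
/-- The series with only a constant term. -/
def const (σ : Fin q → Deg n) (r : R) : FormalSeries R σ :=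
  ⟨fun l => if l = 0 then r else 0, fun l hl =>
    if_neg fun h => hl (by rw [h]; exact admissible_zero)⟩

@[simp] theorem const_coeff_zero (r : R) : (const σ r).coeff 0 = r := by simp [const]

theorem const_coeff_of_ne {l : Fin q →₀ ℕ} (hl : l ≠ 0) (r : R) : (const σ r).coeff l = 0 :=
  if_neg hl

theorem const_mem_grade (S : Type*) [CommRing S] [Algebra S R] (r : R) :
    const σ r ∈ grade S (0 : Deg n) := by
  intro μ hμ
  refine const_coeff_of_ne (fun h => hμ ?_) r
  simp [h]

theorem map_const_eq_zero {R' : Type*} [CommRing R'] (φ : R →+* R') {r : R} (hr : φ r = 0) :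
    map φ (const σ r) = 0 := by
  ext l
  by_cases hl : l = 0
  · subst hl
    exact hr
  · change φ ((const σ r).coeff l) = 0
    rw [const_coeff_of_ne hl, map_zero]

end FormalSeries

/-! ### Sections of the structure sheaf -/

namespace RingedSpace

variable {n : ℕ} (X : RingedSpace.{u} n)

theorem res_res {U V W : Opens X.space} (h : V ≤ U) (h' : W ≤ V) (s : X.sec U) :
    X.res h' (X.res h s) = X.res (h'.trans h) s := by
  change (X.sheaf.1.map (homOfLE h').op).hom ((X.sheaf.1.map (homOfLE h).op).hom s) = _
  rw [← AlgCat.comp_apply, ← Functor.map_comp]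
  rfl

variable {X}

theorem eq_of_locally_eq {U : Opens X.space} {s t : X.sec U}
    (H : ∀ m ∈ U, ∃ (V : Opens X.space) (h : V ≤ U), m ∈ V ∧ X.res h s = X.res h t) : s = t := by
  choose V hV hm hst using H
  refine TopCat.Sheaf.eq_of_locally_eq' X.sheaf (fun x : U => V x x.2) U
    (fun x => homOfLE (hV x x.2)) (fun m hm' => ?_) s t fun x => hst x x.2
  exact Opens.mem_iSup.2 ⟨⟨m, hm'⟩, hm m hm'⟩

/-- If a property `R` of local sections passes to restrictions, determines a section on its
domain, and holds for some section near each point, then these sections glue. -/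
theorem exists_section (R : ∀ N : Opens X.space, X.sec N → Prop)
    (hres : ∀ {N N' : Opens X.space} (h : N' ≤ N) (t : X.sec N), R N t → R N' (X.res h t))
    (huniq : ∀ {N : Opens X.space} (t t' : X.sec N), R N t → R N t' → t = t')
    (hex : ∀ m, ∃ N : Opens X.space, m ∈ N ∧ ∃ t : X.sec N, R N t) :
    ∃ s : X.sec ⊤, ∀ m, ∃ N : Opens X.space, m ∈ N ∧ R N (X.res le_top s) := by
  choose N hN t ht using hex
  obtain ⟨s, hs, -⟩ := TopCat.Sheaf.existsUnique_gluing' X.sheaf N ⊤ (fun m => homOfLE le_top)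
    (fun m _ => Opens.mem_iSup.2 ⟨m, hN m⟩) t
    (fun i j => huniq _ _ (hres inf_le_left _ (ht i)) (hres inf_le_right _ (ht j)))
  refine ⟨s, fun m => ⟨N m, hN m, ?_⟩⟩
  have : X.res le_top s = t m := hs m
  rw [this]
  exact ht m

theorem isUnit_res {U V : Opens X.space} (h : V ≤ U) {s : X.sec U} (hs : IsUnit s) :
    IsUnit (X.res h s) := hs.map (X.res h)

/-- Inverses are unique, so local inverses glue. -/
theorem isUnit_of_locally {s : X.sec ⊤}
    (H : ∀ m, ∃ V : Opens X.space, m ∈ V ∧ IsUnit (X.res (le_top : V ≤ ⊤) s)) : IsUnit s := by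
  obtain ⟨t, ht⟩ := exists_section (X := X)
    (fun N t => X.res le_top s * t = 1 ∧ t * X.res le_top s = 1)
    (fun h t ht => by
      rw [← X.res_res le_top h, ← map_mul, ← map_mul, ht.1, ht.2, map_one]
      exact ⟨rfl, rfl⟩)
    (fun t t' ht ht' => left_inv_eq_right_inv ht.2 ht'.1)
    (fun m => by
      obtain ⟨V, hm, w, hw⟩ := H m
      exact ⟨V, hm, ((w⁻¹ : (X.sec V)ˣ) : X.sec V), by rw [← hw]; simp⟩)
  have h1 : s * t = 1 := eq_of_locally_eq fun m _ => by
    obtain ⟨N, hm, hN, -⟩ := ht m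
    exact ⟨N, le_top, hm, by rw [map_mul, map_one, hN]⟩
  have h2 : t * s = 1 := eq_of_locally_eq fun m _ => by
    obtain ⟨N, hm, -, hN⟩ := ht m
    exact ⟨N, le_top, hm, by rw [map_mul, map_one, hN]⟩
  exact ⟨⟨s, t, h1, h2⟩, rfl⟩

/-- A locally finite family of global sections has a sum. -/
theorem exists_hasLocSum {J : Type*} {s : J → X.sec ⊤}
    (H : ∀ m, ∃ V : Opens X.space, m ∈ V ∧ ∃ F : Finset J,
      ∀ j ∉ F, X.res (le_top : V ≤ ⊤) (s j) = 0) :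
    ∃ t, X.HasLocSum s t := by
  classical
  obtain ⟨t, ht⟩ := exists_section (X := X)
    (fun N t => ∃ F : Finset J, (∀ j ∉ F, X.res le_top (s j) = 0) ∧
      ∑ j ∈ F, X.res le_top (s j) = t)
    (by
      rintro N N' h t ⟨F, hF, rfl⟩
      refine ⟨F, fun j hj => ?_, ?_⟩
      · rw [← X.res_res le_top h, hF j hj, map_zero]
      · rw [map_sum]
        exact Finset.sum_congr rfl fun j _ => (X.res_res le_top h _).symm)
    (by
      rintro N t t' ⟨F, hF, rfl⟩ ⟨F', hF', rfl⟩
      have e1 := Finset.sum_subset (f := fun j => X.res (le_top : N ≤ ⊤) (s j))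
        (Finset.subset_union_left : F ⊆ F ∪ F') fun j _ hj => hF j hj
      have e2 := Finset.sum_subset (f := fun j => X.res (le_top : N ≤ ⊤) (s j))
        (Finset.subset_union_right : F' ⊆ F ∪ F') fun j _ hj => hF' j hj
      exact e1.trans e2.symm)
    (fun m => by
      obtain ⟨V, hm, F, hF⟩ := H m
      exact ⟨V, hm, _, F, hF, rfl⟩)
  refine ⟨t, fun m _ => ?_⟩
  obtain ⟨N, hm, F, hF, hsum⟩ := ht m
  exact ⟨N, le_top, hm, F, hF, hsum⟩

theorem HasLocSum.mul_left {J : Type*} {U : Opens X.space} {s : J → X.sec U} {t : X.sec U}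
    (H : X.HasLocSum s t) (r : X.sec U) : X.HasLocSum (fun j => r * s j) (r * t) := by
  intro m hm
  obtain ⟨V, h, hmV, F, hF, hsum⟩ := H m hm
  refine ⟨V, h, hmV, F, fun j hj => by rw [map_mul, hF j hj, mul_zero], ?_⟩
  rw [map_mul, ← hsum, Finset.mul_sum]
  exact Finset.sum_congr rfl fun j _ => map_mul _ _ _

theorem notMem_supp_iff {s : X.sec ⊤} {m : X.space} :
    m ∉ X.supp s ↔ ∃ V : Opens X.space, m ∈ V ∧ X.res (le_top : V ≤ ⊤) s = 0 := by
  simp only [supp, Set.mem_ofPred_eq, not_and, not_forall, not_not]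
  exact ⟨fun h => let ⟨V, _, hm, e⟩ := h trivial; ⟨V, hm, e⟩,
    fun ⟨V, hm, e⟩ _ => ⟨V, le_top, hm, e⟩⟩

theorem isClosed_supp (s : X.sec ⊤) : IsClosed (X.supp s) := by
  rw [← isOpen_compl_iff, isOpen_iff_forall_mem_open]
  intro m hm
  obtain ⟨V, hmV, e⟩ := notMem_supp_iff.1 hm
  exact ⟨V, fun x hx => notMem_supp_iff.2 ⟨V, hx, e⟩, V.2, hmV⟩

theorem supp_mul_subset (r s : X.sec ⊤) : X.supp (r * s) ⊆ X.supp s := by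
  intro m hm
  by_contra h
  obtain ⟨V, hmV, e⟩ := notMem_supp_iff.1 h
  exact notMem_supp_iff.2 ⟨V, hmV, by rw [map_mul, e, mul_zero]⟩ hm

theorem res_eq_zero_of_disjoint_supp {s : X.sec ⊤} {V : Opens X.space}
    (h : Disjoint (X.supp s) V) : X.res (le_top : V ≤ ⊤) s = 0 := by
  refine eq_of_locally_eq fun m hm => ?_
  obtain ⟨W, hmW, e⟩ := notMem_supp_iff.1 (h.notMem_of_mem_right hm)
  refine ⟨W ⊓ V, inf_le_right, ⟨hmW, hm⟩, ?_⟩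
  rw [X.res_res, map_zero, ← X.res_res le_top (inf_le_left : W ⊓ V ≤ W), e, map_zero]

/-! ### Sections of degree zero -/

/-- Restrictions respect the decomposition into homogeneous components, so homogeneity can be
checked locally. -/
theorem mem_grade_of_locally {U : Opens X.space} {s : X.sec U} {g : Deg n}
    (H : ∀ m ∈ U, ∃ (V : Opens X.space) (h : V ≤ U), m ∈ V ∧ X.res h s ∈ X.grade V g) :
    s ∈ X.grade U g := by
  classical
  let : ∀ V, DirectSum.Decomposition (X.grade V) := fun V => (X.isInternal V).chooseDecomposition
  have key : ((DirectSum.decompose (X.grade U) s g : X.grade U g) : X.sec U) = s := by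
    refine eq_of_locally_eq fun m hm => ?_
    obtain ⟨V, h, hmV, hV⟩ := H m hm
    refine ⟨V, h, hmV, ?_⟩
    have e : X.res h s = ∑ k, X.res h (DirectSum.decompose (X.grade U) s k : X.sec U) := by
      conv_lhs => rw [← DirectSum.sum_support_decompose (X.grade U) s]
      rw [map_sum]
      refine Finset.sum_subset (Finset.subset_univ _) fun k _ hk => ?_
      rw [DFinsupp.notMem_support_iff.1 hk, ZeroMemClass.coe_zero, map_zero]
    have e2 := DirectSum.decompose_of_mem_same (X.grade V) hV
    have hmem (k : Deg n) :
        X.res h (DirectSum.decompose (X.grade U) s k : X.sec U) ∈ X.grade V k :=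
      X.map_grade h k _ (SetLike.coe_mem _)
    rw [e, DirectSum.decompose_sum, DFinsupp.finsetSum_apply, AddSubmonoidClass.coe_finsetSum,
      Finset.sum_eq_single g, DirectSum.decompose_of_mem_same _ (hmem g), ← e] at e2
    · exact e2
    · intro k _ hk
      exact DirectSum.decompose_of_mem_ne _ (hmem k) hk
    · simp
  rw [← key]
  exact SetLike.coe_mem _

theorem one_mem_grade (U : Opens X.space) : (1 : X.sec U) ∈ X.grade U 0 :=
  (X.graded_mul U).one_mem

theorem mul_mem_grade_zero {U : Opens X.space} {s t : X.sec U} (hs : s ∈ X.grade U 0)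
    (ht : t ∈ X.grade U 0) : s * t ∈ X.grade U 0 := by
  simpa using (X.graded_mul U).mul_mem hs ht

/-- Each component of nonzero degree of the inverse of a section of degree `0` is killed by
that section. -/
theorem mem_grade_zero_of_mul_eq_one {U : Opens X.space} {s t : X.sec U} (hs : s ∈ X.grade U 0)
    (hst : s * t = 1) (hts : t * s = 1) : t ∈ X.grade U 0 := by
  classical
  let := X.graded_mul U
  let : DirectSum.Decomposition (X.grade U) := (X.isInternal U).chooseDecomposition
  let : GradedRing (X.grade U) := { X.graded_mul U, (X.isInternal U).chooseDecomposition with }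
  have key : s * (DirectSum.decompose (X.grade U) t 0 : X.sec U) = 1 := by
    have := DirectSum.coe_decompose_mul_add_of_left_mem (X.grade U) (j := 0) (b := t) hs
    rw [hst, add_zero, DirectSum.decompose_of_mem_same _ (one_mem_grade U)] at this
    exact this.symm
  have : t = (DirectSum.decompose (X.grade U) t 0 : X.sec U) := left_inv_eq_right_inv hts key
  rw [this]
  exact SetLike.coe_mem _

theorem HasLocSum.mem_grade {J : Type*} {U : Opens X.space} {s : J → X.sec U} {t : X.sec U}
    {g : Deg n} (H : X.HasLocSum s t) (hs : ∀ j, s j ∈ X.grade U g) : t ∈ X.grade U g := by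
  refine mem_grade_of_locally fun m hm => ?_
  obtain ⟨V, h, hmV, F, -, hsum⟩ := H m hm
  exact ⟨V, h, hmV, hsum ▸ Submodule.sum_mem _ fun j _ => X.map_grade h g _ (hs j)⟩

end RingedSpace
/-! ### Values of sections -/

section Smooth

variable {p : ℕ} {W : Opens (EuclideanSpace ℝ (Fin p))}

/-- Evaluation of smooth functions at a point, as an algebra homomorphism. -/
def Smooth.eval (x : W) : Smooth W →ₐ[ℝ] ℝ where
  toFun g := g x
  map_one' := rfl
  map_mul' _ _ := rfl
  map_zero' := rfl
  map_add' _ _ := rfl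
  commutes' _ := rfl

theorem Smooth.isUnit_of_ne_zero {g : Smooth W} (hg : ∀ x, g x ≠ 0) : IsUnit g := by
  refine IsUnit.of_mul_eq_one ⟨fun x => (g x)⁻¹, g.contMDiff.inv₀ hg⟩ ?_
  ext x
  exact mul_inv_cancel₀ (hg x)

end Smooth

namespace RingedSpace

variable {n : ℕ} {X : RingedSpace.{u} n}

/-- A global section is invertible near `m` if it is so on some neighbourhood of `m`. -/
def InvertibleNear (m : X.space) (s : X.sec ⊤) : Prop :=
  ∃ V : Opens X.space, m ∈ V ∧ IsUnit (X.res (le_top : V ≤ ⊤) s)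

/-- `φ` is the evaluation of global sections at `m`: its kernel consists of the sections that are
not invertible near `m`. -/
def IsEval (m : X.space) (φ : X.sec ⊤ →ₐ[ℝ] ℝ) : Prop :=
  ∀ s, φ s ≠ 0 ↔ InvertibleNear m s

/-- The value `φ s` is the only `k` for which `s - k` is not invertible near `m`. -/
theorem IsEval.eq_iff {m : X.space} {φ : X.sec ⊤ →ₐ[ℝ] ℝ} (h : IsEval m φ) (s : X.sec ⊤) (k : ℝ) :
    k = φ s ↔ ¬ InvertibleNear m (s - algebraMap ℝ (X.sec ⊤) k) := by
  rw [← h, not_not, map_sub, AlgHom.commutes, sub_eq_zero, eq_comm]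
  rfl

theorem IsEval.unique {m : X.space} {φ ψ : X.sec ⊤ →ₐ[ℝ] ℝ} (hφ : IsEval m φ) (hψ : IsEval m ψ) :
    φ = ψ := by
  ext s
  rw [hψ.eq_iff, ← hφ.eq_iff]

theorem IsEval.eq_zero_of_notMem_supp {m : X.space} {φ : X.sec ⊤ →ₐ[ℝ] ℝ} (h : IsEval m φ)
    {s : X.sec ⊤} (hm : m ∉ X.supp s) : φ s = 0 := by
  by_contra hs
  obtain ⟨V, hmV, hV⟩ := (h s).1 hs
  obtain ⟨W, hmW, hW⟩ := notMem_supp_iff.1 hm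
  -- Near `m` the unit `s` vanishes, so that `0` itself is invertible there.
  refine (h 0).2 ⟨V ⊓ W, ⟨hmV, hmW⟩, ?_⟩ (map_zero φ)
  have := isUnit_res (inf_le_left : V ⊓ W ≤ V) hV
  rwa [X.res_res, ← X.res_res le_top (inf_le_right : V ⊓ W ≤ W), hW, map_zero,
    ← map_zero (X.res (le_top : V ⊓ W ≤ ⊤))] at this

theorem isProjection_of_isEval {φ : X.space → X.sec ⊤ →ₐ[ℝ] ℝ} (h : ∀ m, IsEval m (φ m))
    (s : X.sec ⊤) : X.IsProjection s fun m => φ m s := by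
  intro m _ k
  rw [(h m).eq_iff, InvertibleNear, not_exists]
  refine forall_congr' fun V => ?_
  rw [not_and, forall_prop_of_true le_top, map_sub, AlgHom.commutes]

end RingedSpace

namespace Superchart

open RingedSpace

variable {n p q : ℕ} {X : RingedSpace.{u} n} {σ : Fin q → Deg n} (c : Superchart X p σ)

/-- The target of a superchart, as an open set. -/
def target : Opens (EuclideanSpace ℝ (Fin p)) := ⟨c.base.target, c.base.open_target⟩

/-- The expression of a global section in a superchart. -/
def expr : X.sec ⊤ →ₐ[ℝ] DomainFun σ c.target :=
  (c.pullback c.target le_rfl).symm.toAlgHom.comp (X.res le_top)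

/-- The constant coefficient of the expression of a global section in a superchart: the smooth
function underlying the section. -/
def body : X.sec ⊤ →ₐ[ℝ] Smooth c.target :=
  (FormalSeries.constantCoeff ℝ).comp c.expr

theorem pullback_expr (s : X.sec ⊤) :
    c.pullback c.target le_rfl (c.expr s) = X.res le_top s :=
  (c.pullback c.target le_rfl).apply_symm_apply _

theorem res_eq_pullback_restrict (s : X.sec ⊤) {W : Opens (EuclideanSpace ℝ (Fin p))}
    (h : W ≤ c.target) :
    X.res (le_top : chartPreimage c.base W ≤ ⊤) s = c.pullback W h ((c.expr s).restrict h) := by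
  rw [← c.res_pullback c.target W le_rfl h h, pullback_expr, res_res]

theorem isEval_body {m : X.space} (hm : m ∈ c.base.source) :
    IsEval m ((Smooth.eval (⟨c.base m, c.base.map_source hm⟩ : c.target)).comp c.body) := by
  intro s
  constructor
  · intro hs
    let W : Opens (EuclideanSpace ℝ (Fin p)) :=
      ⟨Subtype.val '' {x : c.target | c.body s x ≠ 0},
        c.target.isOpen.isOpenMap_subtype_val _
          (isOpen_ne_fun (c.body s).contMDiff.continuous continuous_const)⟩
    have hW : W ≤ c.target := by
      rintro _ ⟨x, -, rfl⟩
      exact x.2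
    refine ⟨chartPreimage c.base W, ⟨hm, ⟨_, hs, rfl⟩⟩, ?_⟩
    rw [c.res_eq_pullback_restrict s hW]
    refine IsUnit.map _ (FormalSeries.isUnit_of_isUnit_coeff_zero (Smooth.isUnit_of_ne_zero ?_))
    rintro ⟨_, x, hx, rfl⟩
    exact hx
  · rintro ⟨V, hmV, hV⟩
    let W : Opens (EuclideanSpace ℝ (Fin p)) :=
      ⟨c.base.target ∩ c.base.symm ⁻¹' V, c.base.isOpen_inter_preimage_symm V.2⟩
    have hW : W ≤ c.target := fun x hx => hx.1
    have hWV : chartPreimage c.base W ≤ V := by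
      rintro x ⟨hx, -, hx'⟩
      have : c.base.symm (c.base x) ∈ V := hx'
      rwa [c.base.left_inv hx] at this
    have hmW : c.base m ∈ W :=
      ⟨c.base.map_source hm, by
        change c.base.symm (c.base m) ∈ V
        rwa [c.base.left_inv hm]⟩
    have h1 := isUnit_res hWV hV
    rw [res_res, c.res_eq_pullback_restrict s hW] at h1
    have h2 : IsUnit ((c.expr s).restrict hW) := by
      simpa using h1.map (c.pullback W hW).symm
    exact ((h2.map (FormalSeries.constantCoeff ℝ)).map (Smooth.eval ⟨c.base m, hmW⟩)).ne_zero

end Superchart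

namespace Supermanifold

open RingedSpace

variable {n p : ℕ} {d : {k : Deg n // k ≠ 0} → ℕ} (M : Supermanifold.{u} n p d)

theorem exists_isEval (m : M.space) : ∃ φ : M.sec ⊤ →ₐ[ℝ] ℝ, IsEval m φ := by
  obtain ⟨q, σ, -, c, hm⟩ := M.exists_superchart m
  exact ⟨_, c.isEval_body hm⟩

/-- Evaluation of global sections at a point: `eval m s = ε(s)(m)`. -/
def eval (m : M.space) : M.sec ⊤ →ₐ[ℝ] ℝ := (M.exists_isEval m).choose

theorem isEval_eval (m : M.space) : IsEval m (M.eval m) := (M.exists_isEval m).choose_spec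

variable {M}

theorem eval_eq_body {q : ℕ} {σ : Fin q → Deg n} (c : Superchart M.toRingedSpace p σ)
    {m : M.space} (hm : m ∈ c.base.source) (s : M.sec ⊤) :
    M.eval m s = c.body s ⟨c.base m, c.base.map_source hm⟩ := by
  rw [(M.isEval_eval m).unique (c.isEval_body hm)]
  rfl

/-- In each superchart, the projection of a section is the constant coefficient of its expression,
so no compatibility between supercharts is needed. -/
theorem isSmooth_eval (s : M.sec ⊤) : M.IsSmooth fun m => M.eval m s := by
  intro q σ _ c x hx
  have h : ContMDiffAt 𝓘(ℝ, EuclideanSpace ℝ (Fin p)) 𝓘(ℝ, ℝ) ∞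
      (fun y : c.target => (fun x => M.eval (c.base.symm x) s) y) ⟨x, hx⟩ := by
    have h0 := (c.body s).contMDiff.contMDiffAt (x := ⟨x, hx⟩)
    refine h0.congr_of_eventuallyEq (Filter.Eventually.of_forall fun y => ?_)
    have hy : c.base.symm y ∈ c.base.source := c.base.map_target y.2
    change M.eval (c.base.symm y) s = _
    rw [eval_eq_body c hy]
    congr 1
    exact Subtype.ext (c.base.right_inv y.2)
  exact (contMDiffAt_subtype_iff (f := fun x => M.eval (c.base.symm x) s).1
    h).contDiffAt.contDiffWithinAt

variable (M) in
/-- The base of a supermanifold is a topological manifold, hence locally compact. -/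
theorem locallyCompactSpace : LocallyCompactSpace M.space := by
  choose q σ hσ c hc using M.exists_superchart
  let _ : ChartedSpace (EuclideanSpace ℝ (Fin p)) M.space :=
    { atlas := Set.range fun m => (c m).base
      chartAt := fun m => (c m).base
      mem_chart_source := hc
      chart_mem_atlas := fun m => ⟨m, rfl⟩ }
  exact ChartedSpace.locallyCompactSpace (EuclideanSpace ℝ (Fin p)) M.space

/-! ### Bump sections -/

/-- A smooth bump function in a superchart, viewed as a series without formal variables and
extended by zero, is a global section of degree `0`. -/
theorem exists_bump {q : ℕ} {σ : Fin q → Deg n} (c : Superchart M.toRingedSpace p σ)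
    {C V : Set M.space} (hC : IsCompact C) (hV : IsOpen V) (hCV : C ⊆ V)
    (hVc : V ⊆ c.base.source) :
    ∃ s ∈ M.grade ⊤ 0, IsCompact (M.supp s) ∧ M.supp s ⊆ V ∧ (∀ m, 0 ≤ M.eval m s) ∧
      ∀ m ∈ C, 0 < M.eval m s := by
  have hCc : IsCompact (c.base '' C) :=
    hC.image_of_continuousOn (c.base.continuousOn.mono (hCV.trans hVc))
  obtain ⟨K, hK, hCK, hKV⟩ := exists_compact_between hCc
    (c.base.isOpen_image_of_subset_source hV hVc) (Set.image_mono hCV)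
  have hKt : K ⊆ c.base.target := by
    intro x hx
    obtain ⟨y, hy, rfl⟩ := hKV hx
    exact c.base.map_source (hVc hy)
  obtain ⟨φ, hφ1, hφ0, hφ⟩ := exists_contMDiffMap_one_nhds_of_subset_interior
    𝓘(ℝ, EuclideanSpace ℝ (Fin p)) (n := ⊤)
    hCc.isClosed hCK
  have hL : IsCompact (c.base.symm '' K) :=
    hK.image_of_continuousOn (c.base.continuousOn_symm.mono hKt)
  have hLV : c.base.symm '' K ⊆ V := by
    rintro _ ⟨x, hx, rfl⟩
    obtain ⟨y, hy, rfl⟩ := hKV hx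
    rwa [c.base.left_inv (hVc hy)]
  let g : Smooth c.target := ⟨fun x => φ x, φ.contMDiff.comp contMDiff_subtype_val⟩
  let f : DomainFun σ c.target := FormalSeries.const σ g
  let A : Opens M.space := chartPreimage c.base c.target
  let B : Opens M.space := ⟨(c.base.symm '' K)ᶜ, hL.isClosed.isOpen_compl⟩
  let t : M.sec A := c.pullback c.target le_rfl f
  -- The bump function vanishes off `K`, so `t` and the zero section agree on `A ⊓ B` and glue.
  have ht0 : ∀ {N : Opens M.space} (hA : N ≤ A), N ≤ B → M.res hA t = 0 := by
    intro N hA hB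
    let W : Opens (EuclideanSpace ℝ (Fin p)) :=
      ⟨c.base.target ∩ Kᶜ, c.base.open_target.inter hK.isClosed.isOpen_compl⟩
    have hW : W ≤ c.target := fun x hx => hx.1
    have hNW : N ≤ chartPreimage c.base W := by
      intro x hx
      refine ⟨(hA hx).1, (hA hx).2, fun hxK => hB hx ⟨c.base x, hxK, c.base.left_inv (hA hx).1⟩⟩
    rw [← M.res_res (chartPreimage_mono c.base hW) hNW,
      show M.res _ t = _ from c.res_pullback _ W le_rfl hW hW f]
    have : f.restrict hW = 0 := by
      refine FormalSeries.map_const_eq_zero _ ?_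
      ext x
      exact hφ0 _ x.2.2
    rw [this, map_zero, map_zero]
  obtain ⟨s, hs⟩ := exists_section (X := M.toRingedSpace)
    (fun N r => (∃ h : N ≤ A, r = M.res h t) ∨ (N ≤ B ∧ r = 0))
    (by
      rintro N N' h r (⟨hA, rfl⟩ | ⟨hB, rfl⟩)
      · exact Or.inl ⟨h.trans hA, M.res_res _ _ _⟩
      · exact Or.inr ⟨h.trans hB, map_zero _⟩)
    (by
      rintro N r r' (⟨hA, rfl⟩ | ⟨hB, rfl⟩) (⟨hA', rfl⟩ | ⟨hB', rfl⟩)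
      · rfl
      · exact ht0 hA hB'
      · exact (ht0 hA' hB).symm
      · rfl)
    (fun m => by
      by_cases hm : m ∈ B
      · exact ⟨B, hm, 0, Or.inr ⟨le_rfl, rfl⟩⟩
      · have hm' : m ∈ c.base.source := hVc (hLV (not_not.1 hm))
        exact ⟨A, ⟨hm', c.base.map_source hm'⟩, M.res le_rfl t, Or.inl ⟨le_rfl, rfl⟩⟩)
  have hsA : M.res (le_top : A ≤ ⊤) s = t := by
    refine eq_of_locally_eq fun m hm => ?_
    obtain ⟨N, hmN, hN⟩ := hs m
    refine ⟨N ⊓ A, inf_le_right, ⟨hmN, hm⟩, ?_⟩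
    rw [M.res_res, ← M.res_res le_top (inf_le_left : N ⊓ A ≤ N)]
    rcases hN with ⟨hA, e⟩ | ⟨hB, e⟩
    · rw [e, M.res_res]
    · rw [e, map_zero, ht0 _ (inf_le_left.trans hB)]
  have hsupp : M.supp s ⊆ c.base.symm '' K := by
    intro m hm
    by_contra hmL
    refine notMem_supp_iff.2 ?_ hm
    obtain ⟨N, hmN, hN⟩ := hs m
    refine ⟨N ⊓ B, ⟨hmN, hmL⟩, ?_⟩
    rw [← M.res_res le_top (inf_le_left : N ⊓ B ≤ N)]
    rcases hN with ⟨hA, e⟩ | ⟨hB, e⟩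
    · rw [e, M.res_res, ht0 _ inf_le_right]
    · rw [e, map_zero]
  have hbody : c.body s = g := by
    have : c.expr s = f := by
      change (c.pullback c.target le_rfl).symm (M.res (le_top : A ≤ ⊤) s) = f
      rw [hsA]
      exact (c.pullback c.target le_rfl).symm_apply_apply f
    change (c.expr s).coeff 0 = g
    rw [this]
    exact FormalSeries.const_coeff_zero g
  refine ⟨s, ?_, hL.of_isClosed_subset (isClosed_supp s) hsupp, hsupp.trans hLV, fun m => ?_,
    fun m hm => ?_⟩
  · refine mem_grade_of_locally fun m _ => ?_
    obtain ⟨N, hmN, hN⟩ := hs m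
    refine ⟨N, le_top, hmN, ?_⟩
    rcases hN with ⟨hA, e⟩ | ⟨hB, e⟩
    · rw [e]
      exact M.map_grade hA 0 _
        ((c.pullback_mem_grade _ _ _ _).2 (FormalSeries.const_mem_grade ℝ g))
    · rw [e]
      exact Submodule.zero_mem _
  · by_cases hm : m ∈ c.base.source
    · rw [eval_eq_body c hm, hbody]
      exact (hφ _).1
    · rw [(M.isEval_eval m).eq_zero_of_notMem_supp fun h => hm (hVc (hLV (hsupp h)))]
  · rw [eval_eq_body c (hVc (hCV hm)), hbody]
    have : φ (c.base m) = 1 := hφ1.self_of_nhdsSet _ ⟨m, hm, rfl⟩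
    change 0 < φ (c.base m)
    rw [this]
    exact one_pos

/-- Every open cover has a locally finite refinement by relatively compact open sets, each inside
the source of a superchart. -/
theorem exists_locallyFinite_refinement {ι : Type v} (U : ι → Opens M.space)
    (hU : (⨆ i, U i) = ⊤) :
    ∃ (J : Type u) (V : J → Opens M.space), (⨆ j, V j) = ⊤ ∧
      LocallyFinite (fun j => (V j : Set M.space)) ∧ (∀ j, ∃ i, V j ≤ U i) ∧
      (∀ j, ∃ K, IsCompact K ∧ (V j : Set M.space) ⊆ K) ∧
      ∀ j, ∃ (q : ℕ) (σ : Fin q → Deg n) (c : Superchart M.toRingedSpace p σ),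
        (V j : Set M.space) ⊆ c.base.source := by
  have := M.locallyCompactSpace
  let good (m : M.space) (V : Opens M.space) : Prop :=
    m ∈ V ∧ (∃ i, V ≤ U i) ∧ (∃ K, IsCompact K ∧ (V : Set M.space) ⊆ K) ∧
      ∃ (q : ℕ) (σ : Fin q → Deg n) (c : Superchart M.toRingedSpace p σ),
        (V : Set M.space) ⊆ c.base.source
  have hB : ∀ m, (nhds m).HasBasis (good m) fun V => (V : Set M.space) := by
    intro m
    refine ⟨fun t => ⟨fun ht => ?_, fun ⟨V, hV, hVt⟩ => ?_⟩⟩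
    · obtain ⟨i, hi⟩ := Opens.mem_iSup.1 (hU ▸ Opens.mem_top m : m ∈ ⨆ i, U i)
      obtain ⟨q, σ, -, c, hc⟩ := M.exists_superchart m
      obtain ⟨K, hK, hmK⟩ := exists_compact_mem_nhds m
      refine ⟨⟨interior t ∩ U i ∩ c.base.source ∩ interior K,
        ((isOpen_interior.inter (U i).2).inter c.base.open_source).inter isOpen_interior⟩,
        ⟨⟨⟨⟨mem_interior_iff_mem_nhds.2 ht, hi⟩, hc⟩, mem_interior_iff_mem_nhds.2 hmK⟩,
        ⟨i, fun x hx => hx.1.1.2⟩, ⟨K, hK, fun x hx => interior_subset hx.2⟩,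
        q, _, c, fun x hx => hx.1.2⟩, fun x hx => interior_subset hx.1.1.1⟩
    · exact Filter.mem_of_superset (V.2.mem_nhds hV.1) hVt
  obtain ⟨J, x, V, hV, hcov, hfin⟩ := refinement_of_locallyCompact_sigmaCompact_of_nhds_basis hB
  refine ⟨J, V, ?_, hfin, fun j => (hV j).2.1, fun j => (hV j).2.2.1, fun j => (hV j).2.2.2⟩
  exact Opens.ext (by rw [Opens.coe_iSup, hcov, Opens.coe_top])

end Supermanifold

end Z2n
end

/-! ### Partitions of unity -/

open Z2n RingedSpace Supermanifold in
/-- Every open cover `U` of a `ℤ₂ⁿ`-supermanifold `M` has a subordinate partition of unity `s`,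
with respect to a locally finite open refinement `V`; the functions `γ j` are the projections
`ε (s j)`. -/
theorem proposition7p6 {n p : ℕ} {d : {k : Z2n.Deg n // k ≠ 0} → ℕ}
    (M : Z2n.Supermanifold.{u} n p d) {ι : Type v} (U : ι → TopologicalSpace.Opens M.space)
    (hU : (⨆ i, U i) = ⊤) :
    ∃ (J : Type u) (V : J → TopologicalSpace.Opens M.space) (s : J → M.sec ⊤)
      (γ : J → M.space → ℝ),
      (⨆ j, V j) = ⊤ ∧ LocallyFinite (fun j => (V j : Set M.space)) ∧ (∀ j, ∃ i, V j ≤ U i) ∧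
      (∀ j, s j ∈ M.grade ⊤ 0) ∧
      (∀ j, M.IsProjection (s j) (γ j) ∧ M.IsSmooth (γ j) ∧ ∀ m, 0 ≤ γ j m) ∧
      (∀ j, IsCompact (M.supp (s j)) ∧ M.supp (s j) ⊆ V j) ∧
      M.HasLocSum s 1 := by
  obtain ⟨J, V, hcov, hfin, hVU, hVK, hVc⟩ := exists_locallyFinite_refinement U hU
  have := M.locallyCompactSpace
  obtain ⟨C, hCcov, hCcl, hCV⟩ := exists_iUnion_eq_closed_subset (fun j => (V j).2)
    hfin.point_finite (by rw [← Opens.coe_top, ← hcov, Opens.coe_iSup]; rfl)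
  have hbump : ∀ j, ∃ s ∈ M.grade ⊤ 0, IsCompact (M.supp s) ∧ M.supp s ⊆ V j ∧
      (∀ m, 0 ≤ M.eval m s) ∧ ∀ m ∈ C j, 0 < M.eval m s := fun j => by
    obtain ⟨K, hK, hVK⟩ := hVK j
    obtain ⟨q, σ, c, hVc⟩ := hVc j
    exact exists_bump c (hK.of_isClosed_subset (hCcl j) ((hCV j).trans hVK)) (V j).2 (hCV j) hVc
  choose b hb0 hbK hbV hbn hbp using hbump
  have hloc : ∀ m, ∃ N : Opens M.space, m ∈ N ∧ ∃ F : Finset J,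
      ∀ j ∉ F, M.res (le_top : N ≤ ⊤) (b j) = 0 := by
    intro m
    obtain ⟨t, ht, htf⟩ := hfin m
    refine ⟨⟨interior t, isOpen_interior⟩, mem_interior_iff_mem_nhds.2 ht, htf.toFinset,
      fun j hj => res_eq_zero_of_disjoint_supp ?_⟩
    refine Set.disjoint_left.2 fun x hx hxt => hj ?_
    rw [Set.Finite.mem_toFinset]
    exact ⟨x, hbV j hx, interior_subset hxt⟩
  obtain ⟨S, hS⟩ := exists_hasLocSum hloc
  have hSpos : ∀ m, 0 < M.eval m S := by
    intro m
    obtain ⟨N, hN, hmN, F, hF, hsum⟩ := hS m trivial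
    -- Evaluation is local, so it takes `S` to the finite sum of the values of the `b j` at `m`.
    have e : M.eval m S = ∑ j ∈ F, M.eval m (b j) := by
      rw [← map_sum, ← sub_eq_zero, ← map_sub]
      refine (M.isEval_eval m).eq_zero_of_notMem_supp (notMem_supp_iff.2 ⟨N, hmN, ?_⟩)
      rw [map_sub, map_sum, hsum, sub_self]
    obtain ⟨j, hj⟩ := Set.mem_iUnion.1 (hCcov ▸ Set.mem_univ m : m ∈ ⋃ j, C j)
    rw [e]
    refine Finset.sum_pos' (fun j _ => hbn j m) ⟨j, ?_, hbp j m hj⟩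
    by_contra hjF
    have := (M.isEval_eval m).eq_zero_of_notMem_supp (notMem_supp_iff.2 ⟨N, hmN, hF j hjF⟩)
    exact (hbp j m hj).ne' this
  obtain ⟨T, hTS, hST⟩ := isUnit_iff_exists.1
    (isUnit_of_locally fun m => (M.isEval_eval m S).1 (hSpos m).ne')
  have hT0 : T ∈ M.grade ⊤ 0 := mem_grade_zero_of_mul_eq_one (hS.mem_grade hb0) hTS hST
  have hTpos : ∀ m, 0 ≤ M.eval m T := by
    intro m
    have h1 : M.eval m T * M.eval m S = 1 := by rw [← map_mul, hST, map_one]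
    exact (pos_of_mul_pos_left (h1 ▸ one_pos) (hSpos m).le).le
  refine ⟨J, V, fun j => T * b j, fun j m => M.eval m (T * b j), hcov, hfin, hVU,
    fun j => mul_mem_grade_zero hT0 (hb0 j), fun j => ⟨isProjection_of_isEval M.isEval_eval _,
    isSmooth_eval _, fun m => ?_⟩, fun j => ⟨?_, (supp_mul_subset _ _).trans (hbV j)⟩, ?_⟩
  · change 0 ≤ M.eval m (T * b j)
    rw [map_mul]
    exact mul_nonneg (hTpos m) (hbn j m)
  · exact (hbK j).of_isClosed_subset (isClosed_supp _) (supp_mul_subset _ _)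
  · rw [← hST]
    exact hS.mul_left T
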